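/- Fix an integer $d\ge 1$. Let $K\subset\mathbb R^d$ be a $d$-dimensional convex polytope, i.e. the convex hull of finitely many points whose affine hull is $\mathbb R^d$. Its faces are the intersections of $K$ with its supporting hyperplanes; $V$ is the set of vertices (faces of dimension $0$) and $F$ the set of facets (faces of dimension $d-1$). Assume that $K$ is non-degenerate (distinct facets do not lie in the same hyperplane) and simple (each vertex is contained in exactly $d$ facets). Let $|\cdot|$ denote both the Euclidean norm and cardinality, and put - $h_K$: the diameter of $K$; - $h_*=\min\{h_f(v): f\in F,\ v\in V,\ v\notin f\}$, where $h_f(v)$ is the distance from $v$ to the hyperplane containing $f$; - $w_K$: the width of $K$, the minimal distance between two distinct parallel supporting hyperplanes of $K$; - $\rho_K$: the radius of the largest ball contained in $K$. Consider the following conditions on $K$, each with its constant: - (H1) with $C_*>0$: $h_*\ge C_*h_K$; - (H2) with $D_*>0$: $|u-v|\ge D_*h_K$ for all $u,v\in V$ with $u\ne v$; - (H3) with a positive integer $N_V^*$: $|V|\le N_V^*$; - (H4) with a positive integer $N_F^*$: $|F|\le N_F^*$; - (H5) with $C>0$: $C\,h_K\le w_K$; - (H5') with $\gamma^*>0$: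 $h_K/\rho_K\le\gamma^*$. Then $$\text{(H1)}\Rightarrow\text{(H2)}\Rightarrow\text{(H3)}\Leftrightarrow\text{(H4)},\qquad \text{(H1)}\Rightarrow\text{(H5)}\Leftrightarrow\text{(H5')},$$ where each implication (A) $\Rightarrow$ (B) holds uniformly in $K$: for every admissible constant in (A) there is an admissible constant in (B), depending only on $d$ and the constant in (A), such that every non-degenerate simple convex polytope $K\subset\mathbb R^d$ satisfying (A) with the first constant satisfies (B) with the second. -/

import Mathlib

namespace PolytopeGeom

/-- A `d`-dimensional convex polytope in `ℝ^d`: the convex hull of a finite set of points whose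
affine hull is all of `ℝ^d`. -/
def IsConvexPolytope {d : ℕ} (K : Set (EuclideanSpace ℝ (Fin d))) : Prop :=
  (∃ s : Set (EuclideanSpace ℝ (Fin d)), s.Finite ∧ K = convexHull ℝ s) ∧ affineSpan ℝ K = ⊤

/-- `f` is a (nonempty) face of `K` of dimension `k`. For nonempty `f`, `IsExposed ℝ K f` says that
`f` is the set of maximizers over `K` of a continuous linear functional; if the functional is
nonzero, this is the intersection of `K` with a supporting hyperplane, and if it is zero, then
`f = K` (the improper face). -/
def IsFaceOfDim {d : ℕ} (K : Set (EuclideanSpace ℝ (Fin d))) (k : ℕ)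
    (f : Set (EuclideanSpace ℝ (Fin d))) : Prop :=
  IsExposed ℝ K f ∧ f.Nonempty ∧ Module.finrank ℝ (vectorSpan ℝ f) = k

/-- The set `V` of vertices of `K`: the points `v` such that `{v}` is a face of dimension `0`. -/
def vertices {d : ℕ} (K : Set (EuclideanSpace ℝ (Fin d))) : Set (EuclideanSpace ℝ (Fin d)) :=
  {v | IsFaceOfDim K 0 {v}}

/-- The set `F` of facets of `K`: the faces of dimension `d - 1` (used for `1 ≤ d`). -/
def facets {d : ℕ} (K : Set (EuclideanSpace ℝ (Fin d))) :
    Set (Set (EuclideanSpace ℝ (Fin d))) :=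
  {f | IsFaceOfDim K (d - 1) f}

/-- Vertices are exactly Mathlib's exposed points. -/
theorem vertices_eq_exposedPoints {d : ℕ} (K : Set (EuclideanSpace ℝ (Fin d))) :
    vertices K = K.exposedPoints ℝ := by
  ext v
  rw [mem_exposedPoints_iff_exposed_singleton]
  constructor
  · exact fun h => h.1
  · exact fun h => ⟨h, Set.singleton_nonempty v, by simp⟩

/-- Non-degeneracy: distinct facets do not lie in the same hyperplane. -/
def IsNonDegenerate {d : ℕ} (K : Set (EuclideanSpace ℝ (Fin d))) : Prop :=
  ∀ f ∈ facets K, ∀ g ∈ facets K, affineSpan ℝ f = affineSpan ℝ g → f = g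

/-- Non-degeneracy is automatic, because facets are defined as faces. -/
theorem isNonDegenerate {d : ℕ} (K : Set (EuclideanSpace ℝ (Fin d))) : IsNonDegenerate K := by
  have key : ∀ f ∈ facets K, ∀ g ∈ facets K,
      affineSpan ℝ f = affineSpan ℝ g → g ⊆ f := by
    intro f hf g hg h x hx
    obtain ⟨l, hl⟩ := hf.1 hf.2.1
    obtain ⟨y, hy⟩ := hf.2.1
    have hsub : f ⊆ (AffineSubspace.mk' y (LinearMap.ker (l : _ →ₗ[ℝ] ℝ)) : Set _) := by
      intro z hz
      have hz' := hz
      have hy' := hy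
      rw [hl] at hz' hy'
      have h1 := hz'.2 y hy'.1
      have h2 := hy'.2 z hz'.1
      simp only [SetLike.mem_coe, AffineSubspace.mem_mk', vsub_eq_sub, LinearMap.mem_ker, map_sub]
      exact sub_eq_zero.2 (le_antisymm h2 h1)
    have hx' := affineSpan_le.2 hsub (h ▸ subset_affineSpan ℝ g hx)
    simp only [AffineSubspace.mem_mk', vsub_eq_sub, LinearMap.mem_ker, map_sub] at hx'
    have hlx : l x = l y := sub_eq_zero.1 hx'
    rw [hl]
    rw [hl] at hy
    exact ⟨hg.1.subset hx, fun z hz => hlx ▸ hy.2 z hz⟩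
  exact fun f hf g hg h => Set.Subset.antisymm (key g hg f hf h.symm) (key f hf g hg h)

/-- A non-degenerate simple convex polytope: each vertex is incident to exactly `d` facets. -/
structure IsSimplePolytope {d : ℕ} (K : Set (EuclideanSpace ℝ (Fin d))) : Prop where
  isConvexPolytope : IsConvexPolytope K
  nonDegenerate : IsNonDegenerate K
  simple : ∀ v ∈ vertices K, {f ∈ facets K | v ∈ f}.encard = d

/-- The distance `h_f(x)` from `x` to the hyperplane containing the facet `f`. -/
noncomputable def facetDist {d : ℕ} (f : Set (EuclideanSpace ℝ (Fin d)))
    (x : EuclideanSpace ℝ (Fin d)) : ℝ :=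
  Metric.infDist x (affineSpan ℝ f : Set (EuclideanSpace ℝ (Fin d)))

/-- `h_*`: the minimum distance between a facet (its hyperplane) and a non-incident vertex. -/
noncomputable def hStar {d : ℕ} (K : Set (EuclideanSpace ℝ (Fin d))) : ℝ :=
  sInf {r | ∃ f ∈ facets K, ∃ v ∈ vertices K, v ∉ f ∧ r = facetDist f v}

/-- The radius `ρ_K` of the largest ball inscribed in `K`. -/
noncomputable def inradius {d : ℕ} (K : Set (EuclideanSpace ℝ (Fin d))) : ℝ :=
  sSup {r | 0 ≤ r ∧ ∃ c, Metric.closedBall c r ⊆ K}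

/-- The width `w_K`: the minimal distance `b - a` of two parallel supporting hyperplanes
`{x | ⟪n, x⟫ = a}` and `{x | ⟪n, x⟫ = b}` of `K`, with `n` a unit normal; `K` lies between them
and touches both. -/
noncomputable def width {d : ℕ} (K : Set (EuclideanSpace ℝ (Fin d))) : ℝ :=
  sInf {w | ∃ (n : EuclideanSpace ℝ (Fin d)) (a b : ℝ), ‖n‖ = 1 ∧
    (∀ x ∈ K, a ≤ inner ℝ n x ∧ inner ℝ n x ≤ b) ∧
    (∃ x ∈ K, inner ℝ n x = a) ∧ (∃ x ∈ K, inner ℝ n x = b) ∧ w = b - a}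

/-- (H1) with constant `C`: `h_* ≥ C h_K`. -/
def H1 {d : ℕ} (C : ℝ) (K : Set (EuclideanSpace ℝ (Fin d))) : Prop :=
  C * Metric.diam K ≤ hStar K

/-- (H2) with constant `D`: distinct vertices have distance at least `D h_K`. -/
def H2 {d : ℕ} (D : ℝ) (K : Set (EuclideanSpace ℝ (Fin d))) : Prop :=
  ∀ u ∈ vertices K, ∀ v ∈ vertices K, u ≠ v → D * Metric.diam K ≤ dist u v

/-- (H3) with constant `N`: at most `N` vertices. -/
def H3 {d : ℕ} (N : ℕ) (K : Set (EuclideanSpace ℝ (Fin d))) : Prop :=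
  (vertices K).encard ≤ N

/-- (H4) with constant `N`: at most `N` facets. -/
def H4 {d : ℕ} (N : ℕ) (K : Set (EuclideanSpace ℝ (Fin d))) : Prop :=
  (facets K).encard ≤ N

/-- (H5) with constant `C`: `C h_K ≤ w_K`. -/
def H5 {d : ℕ} (C : ℝ) (K : Set (EuclideanSpace ℝ (Fin d))) : Prop :=
  C * Metric.diam K ≤ width K

/-- (H5') with constant `γ`: `h_K / ρ_K ≤ γ`. -/
def H5' {d : ℕ} (γ : ℝ) (K : Set (EuclideanSpace ℝ (Fin d))) : Prop :=
  Metric.diam K / inradius K ≤ γ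

end PolytopeGeom

open PolytopeGeom

namespace PolytopeGeom

open Filter Topology

variable {d : ℕ} {K : Set (EuclideanSpace ℝ (Fin d))}

/-! Facets are produced by polar duality. Around an interior point `c`, an extreme point of the
polar of `K` is the normal of a facet: its tight constraints span the space (`span_tight_eq_top`),
so the face it cuts out has dimension `d - 1`. Extreme points of suitable faces of the polar then
give a facet whose hyperplane separates `K` from an outside point, and a facet containing `u` but
not `v` for distinct vertices `u`, `v`.

(H1) ⇒ (H2): with such a facet, `|u - v| ≥ h_f(v) ≥ h_*`. (H2) ⇒ (H3): after rescaling to diameter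
1, this is packing in a unit ball. (H3) ⇔ (H4): a facet is determined by its vertices and a vertex
by its facets, so each count is at most 2 to the power of the other.

(H1) ⇒ (H5): at the mean of the at most `N` vertices, the distance to a facet hyperplane is the mean
of the vertex distances. All are nonnegative and one is at least `C h_K`, so a ball of radius `C h_K
/ N` fits in `K`.

(H5) ⇔ (H5'): `2 ρ_K ≤ w_K` because `K` contains balls, and `w_K ≤ 2d(d+1) ρ_K` because a simplex of
largest volume with one vertex fixed at an interior point contains a large enough ball. -/

theorem exists_norm_eq_one (hd : 1 ≤ d) : ∃ n : EuclideanSpace ℝ (Fin d), ‖n‖ = 1 :=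
  ⟨EuclideanSpace.single ⟨0, hd⟩ 1, by simp⟩

/-! ### Width versus inscribed balls -/

theorem radius_le_diam (hd : 1 ≤ d) (hK : IsCompact K) {c : EuclideanSpace ℝ (Fin d)} {r : ℝ}
    (hr : 0 ≤ r) (h : Metric.closedBall c r ⊆ K) : r ≤ Metric.diam K := by
  obtain ⟨n, hn⟩ := exists_norm_eq_one hd
  have h1 : c + r • n ∈ K := h (by simp [norm_smul, hn, abs_of_nonneg hr])
  have h2 : c ∈ K := h (by simpa using hr)
  simpa [norm_smul, hn, abs_of_nonneg hr] using Metric.dist_le_diam_of_mem hK.isBounded h1 h2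

theorem le_inradius (hd : 1 ≤ d) (hK : IsCompact K) {c : EuclideanSpace ℝ (Fin d)} {r : ℝ}
    (hr : 0 ≤ r) (h : Metric.closedBall c r ⊆ K) : r ≤ inradius K :=
  le_csSup ⟨Metric.diam K, fun _ hs => hs.2.elim fun _ hc => radius_le_diam hd hK hs.1 hc⟩
    ⟨hr, c, h⟩

/-- The slab need not touch `K`: shrinking it to the extreme values of `n` on `K` gives an
admissible one. -/
theorem width_le (hK : IsCompact K) (hne : K.Nonempty) {n : EuclideanSpace ℝ (Fin d)}
    (hn : ‖n‖ = 1) {α β : ℝ} (h : ∀ x ∈ K, α ≤ inner ℝ n x ∧ inner ℝ n x ≤ β) :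
    width K ≤ β - α := by
  have hc : ContinuousOn (fun x => inner ℝ n x : EuclideanSpace ℝ (Fin d) → ℝ) K := by fun_prop
  obtain ⟨p, hp, hpm⟩ := hK.exists_isMinOn hne hc
  obtain ⟨q, hq, hqm⟩ := hK.exists_isMaxOn hne hc
  have hle : width K ≤ inner ℝ n q - inner ℝ n p := by
    refine csInf_le ⟨0, ?_⟩ ⟨n, _, _, hn, fun x hx => ⟨hpm hx, hqm hx⟩, ⟨p, hp, rfl⟩, ⟨q, hq, rfl⟩,
      rfl⟩
    rintro w ⟨m, a, b, -, hab, -, -, rfl⟩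
    have := hab p hp
    linarith
  linarith [h p hp, h q hq]

theorem two_mul_radius_le_width (hd : 1 ≤ d) (hK : IsCompact K)
    {c : EuclideanSpace ℝ (Fin d)} {r : ℝ} (hr : 0 ≤ r) (h : Metric.closedBall c r ⊆ K) :
    2 * r ≤ width K := by
  obtain ⟨n, hn⟩ := exists_norm_eq_one hd
  have hne : K.Nonempty := ⟨c, h (by simpa using hr)⟩
  refine le_csInf ?_ ?_
  -- Nonemptiness matters here, since `sInf ∅ = 0`.
  · have hc : ContinuousOn (fun x => inner ℝ n x : EuclideanSpace ℝ (Fin d) → ℝ) K := by fun_prop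
    obtain ⟨p, hp, hpm⟩ := hK.exists_isMinOn hne hc
    obtain ⟨q, hq, hqm⟩ := hK.exists_isMaxOn hne hc
    exact ⟨_, n, _, _, hn, fun x hx => ⟨hpm hx, hqm hx⟩, ⟨p, hp, rfl⟩, ⟨q, hq, rfl⟩, rfl⟩
  · rintro w ⟨m, a, b, hm, hab, -, -, rfl⟩
    have h1 := hab (c + r • m) (h (by simp [norm_smul, hm, abs_of_nonneg hr]))
    have h2 := hab (c - r • m) (h (by simp [norm_smul, hm, abs_of_nonneg hr]))
    rw [inner_add_right, inner_smul_right, real_inner_self_eq_norm_sq, hm] at h1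
    rw [inner_sub_right, inner_smul_right, real_inner_self_eq_norm_sq, hm] at h2
    linarith [h1.2, h2.1]

theorem two_mul_inradius_le_width (hd : 1 ≤ d) (hK : IsCompact K) (hne : K.Nonempty) :
    2 * inradius K ≤ width K := by
  have : inradius K ≤ width K / 2 := by
    obtain ⟨x, hx⟩ := hne
    refine csSup_le ⟨0, le_rfl, x, by simpa using hx⟩ ?_
    rintro r ⟨hr, c, hc⟩
    linarith [two_mul_radius_le_width hd hK hr hc]
  linarith

/-- After normalising `n`, `K` lies in a slab of thickness `2 / ‖n‖`. This turns the width into a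
bound on dual basis vectors. -/
theorem norm_mul_width_le (hK : IsCompact K) (hne : K.Nonempty)
    {n p : EuclideanSpace ℝ (Fin d)} (h : ∀ x ∈ K, |inner ℝ n (x - p)| ≤ 1) :
    ‖n‖ * width K ≤ 2 := by
  rcases eq_or_ne n 0 with rfl | hn
  · simp
  have hpos : 0 < ‖n‖ := norm_pos_iff.2 hn
  have key := width_le hK hne (n := ‖n‖⁻¹ • n) (by simp [norm_smul, hpos.ne'])
    (α := ‖n‖⁻¹ * (inner ℝ n p - 1)) (β := ‖n‖⁻¹ * (inner ℝ n p + 1)) (fun x hx => by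
      have := abs_le.1 (h x hx)
      rw [inner_sub_right] at this
      rw [real_inner_smul_left]
      constructor <;> gcongr <;> linarith)
  calc ‖n‖ * width K ≤ ‖n‖ * (‖n‖⁻¹ * (inner ℝ n p + 1) - ‖n‖⁻¹ * (inner ℝ n p - 1)) := by gcongr
    _ = 2 := by field_simp; ring

/-! ### Bounding the width by the inradius -/

/-- A compact set with nonempty interior contains a basis (seen from an interior point) with respect
to which all of the set has coordinates in `[-1, 1]`. -/
theorem exists_basis_abs_coord_le_one (hK : IsCompact K) {p : EuclideanSpace ℝ (Fin d)}
    (hp : p ∈ interior K) :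
    ∃ b : Module.Basis (Fin d) ℝ (EuclideanSpace ℝ (Fin d)),
      (∀ i, p + b i ∈ K) ∧ ∀ x ∈ K, ∀ i, |b.coord i (x - p)| ≤ 1 := by
  let e := (EuclideanSpace.basisFun (Fin d) ℝ).toBasis
  obtain ⟨ε, hε, hball⟩ := Metric.nhds_basis_closedBall.mem_iff.1 (mem_interior_iff_mem_nhds.1 hp)
  let S : Set (Fin d → EuclideanSpace ℝ (Fin d)) := Set.univ.pi fun _ => K
  have hS : IsCompact S := isCompact_univ_pi fun _ => hK
  -- The basis comes from `d` points of `K` that maximise the volume of the simplex they span with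
  -- `p`.
  have hcont : Continuous fun q : Fin d → EuclideanSpace ℝ (Fin d) => |e.det fun i => q i - p| := by
    have : Continuous fun q : Fin d → EuclideanSpace ℝ (Fin d) =>
        (e.toMatrix fun i => q i - p).det := by
      refine Continuous.matrix_det (continuous_matrix fun i j => ?_)
      simp only [e, Module.Basis.toMatrix_apply, OrthonormalBasis.coe_toBasis_repr_apply,
        EuclideanSpace.basisFun_repr]
      fun_prop
    exact this.abs
  have hstart : (fun i => p + ε • e i) ∈ S := fun i _ => hball (by
    simp [e, norm_smul, abs_of_pos hε])
  obtain ⟨q, hqS, hq⟩ := hS.exists_isMaxOn ⟨_, hstart⟩ hcont.continuousOn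
  set v : Fin d → EuclideanSpace ℝ (Fin d) := fun i => q i - p with hv
  have hdet : 0 < |e.det v| := by
    refine lt_of_lt_of_le ?_ (hq hstart)
    have : (fun i => p + ε • e i - p) = fun i => ε • e i := by ext1 i; simp
    simp only [this]
    rw [AlternatingMap.map_smul_univ (e.det) (fun _ => ε), Module.Basis.det_self]
    simp [hε.ne']
  obtain ⟨hli, hsp⟩ := (Module.Basis.is_basis_iff_det e).2 (isUnit_iff_ne_zero.2 (abs_pos.1 hdet))
  refine ⟨Module.Basis.mk hli hsp.ge, fun i => by simpa [hv] using hqS i trivial, fun x hx i => ?_⟩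
  -- Cramer's rule: the `i`-th coordinate is the ratio of the determinant with `v i` replaced by `x
  -- - p` to the maximal one.
  have h1 := congrArg (fun f => |f (x - p)|) (e.det_smul_mk_coord_eq_det_update hli hsp.ge i)
  have h2 : |e.det (Function.update v i (x - p))| ≤ |e.det v| := by
    have hmem : Function.update q i x ∈ S := by
      intro j _
      rcases eq_or_ne j i with rfl | hj
      · simpa using hx
      · simpa [hj] using hqS j trivial
    have := hq hmem
    have heq : (fun j => Function.update q i x j - p) = Function.update v i (x - p) := by
      ext1 j
      rcases eq_or_ne j i with rfl | hj
      · simp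
      · simp [hj, hv]
    simpa only [Set.mem_ofPred_eq, heq] using this
  have h3 : |e.det v| * |(Module.Basis.mk hli hsp.ge).coord i (x - p)|
      = |e.det (Function.update v i (x - p))| := by
    rw [← abs_mul]; exact h1
  rw [← h3] at h2
  exact le_of_mul_le_mul_left (by simpa using h2) hdet

/-- The simplex spanned by `p` and `p + b i` contains a ball whose radius is controlled by the
dual basis. -/
theorem exists_closedBall_subset_of_basis (hconv : Convex ℝ K) {p : EuclideanSpace ℝ (Fin d)}
    (hp : p ∈ K) (b : Module.Basis (Fin d) ℝ (EuclideanSpace ℝ (Fin d)))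
    (hb : ∀ i, p + b i ∈ K) {r : ℝ}
    (hr : ∀ i, ∀ y, ‖y‖ ≤ r → |b.coord i y| ≤ 1 / (d * (d + 1))) :
    ∃ c, Metric.closedBall c r ⊆ K := by
  -- The centre is the centroid of the simplex. A displacement changing each coordinate by at most
  -- `1/(d(d+1))` keeps all `d + 1` barycentric coordinates nonnegative.
  refine ⟨p + ∑ i, (1 / (d + 1) : ℝ) • b i, fun z hz => ?_⟩
  set y := z - (p + ∑ i, (1 / (d + 1) : ℝ) • b i) with hy
  have hyr : ‖y‖ ≤ r := by rwa [Metric.mem_closedBall, dist_eq_norm] at hz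
  let μ : Fin d → ℝ := fun i => 1 / (d + 1) + b.coord i y
  have hd1 : (0 : ℝ) < d + 1 := by positivity
  rcases Nat.eq_zero_or_pos d with rfl | hd
  · rwa [Subsingleton.elim z p]
  have hd0 : (1 : ℝ) ≤ d := by exact_mod_cast hd
  have hsmall : (1 : ℝ) / (d * (d + 1)) ≤ 1 / (d + 1) := by
    apply one_div_le_one_div_of_le hd1
    nlinarith
  have hμ0 : ∀ i, 0 ≤ μ i := fun i => by
    have := (abs_le.1 (hr i y hyr)).1
    simp only [μ]
    linarith
  have hμ1 : ∑ i, μ i ≤ 1 := by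
    calc ∑ i, μ i ≤ ∑ _i : Fin d, ((1 : ℝ) / (d + 1) + 1 / (d * (d + 1))) :=
          Finset.sum_le_sum fun i _ => by
            have := (abs_le.1 (hr i y hyr)).2
            simp only [μ]
            linarith
      _ = 1 := by
        simp
        field_simp
  have hz' : z = (1 - ∑ i, μ i) • p + ∑ i, μ i • (p + b i) := by
    have hsum : ∑ i, b.coord i y • b i = y := b.sum_repr y
    have : z = p + ∑ i, (1 / (d + 1) : ℝ) • b i + y := by simp [hy]
    simp only [smul_add, Finset.sum_add_distrib, μ, add_smul, hsum, sub_smul, one_smul,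
      Finset.sum_smul]
    rw [this]
    abel
  -- In `Option (Fin d)`, `none` stands for the vertex `p`, with the remaining weight.
  have := hconv.sum_mem (t := Finset.univ) (w := fun o : Option (Fin d) => o.elim (1 - ∑ i, μ i) μ)
    (z := fun o => o.elim p fun i => p + b i)
    (by rintro (_ | i) _
        · simpa using hμ1
        · exact hμ0 i)
    (by simp [Fintype.sum_option])
    (by rintro (_ | i) _
        · exact hp
        · exact hb i)
  rw [hz']
  simpa [Fintype.sum_option] using this

/-- A weak form of Steinhagen's inequality. -/
theorem width_le_mul_inradius (hd : 1 ≤ d) (hK : IsCompact K) (hconv : Convex ℝ K)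
    (hint : (interior K).Nonempty) : width K ≤ 2 * (d * (d + 1)) * inradius K := by
  obtain ⟨p, hp⟩ := hint
  have hpK := interior_subset hp
  obtain ⟨b, hb, hcoord⟩ := exists_basis_abs_coord_le_one hK hp
  have hd0 : (0 : ℝ) < d := by exact_mod_cast hd
  have hD : (0 : ℝ) < d * (d + 1) := by positivity
  obtain ⟨ε, hε, hball⟩ := Metric.nhds_basis_closedBall.mem_iff.1 (mem_interior_iff_mem_nhds.1 hp)
  have hw : 0 ≤ width K := le_trans (by positivity) (two_mul_radius_le_width hd hK hε.le hball)
  obtain ⟨c, hc⟩ := exists_closedBall_subset_of_basis hconv hpK b hb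
    (r := width K / (2 * (d * (d + 1)))) (fun i y hy => by
      let n := (InnerProductSpace.toDual ℝ (EuclideanSpace ℝ (Fin d))).symm
        (LinearMap.toContinuousLinearMap (b.coord i))
      have hn : ∀ x, inner ℝ n x = b.coord i x := fun x => by simp [n]
      have h1 := norm_mul_width_le hK ⟨p, hpK⟩ (n := n) (p := p)
        (fun x hx => by rw [hn]; exact hcoord x hx i)
      rw [← hn]
      calc |inner ℝ n y| ≤ ‖n‖ * ‖y‖ := abs_real_inner_le_norm _ _
        _ ≤ ‖n‖ * (width K / (2 * (d * (d + 1)))) := by gcongr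
        _ = ‖n‖ * width K / (2 * (d * (d + 1))) := by ring
        _ ≤ 2 / (2 * (d * (d + 1))) := by gcongr
        _ = 1 / (d * (d + 1)) := by field_simp)
  have := le_inradius hd hK (by positivity) hc
  rw [div_le_iff₀ (by positivity)] at this
  linarith

/-! ### Polytopes and their vertices -/

theorem IsConvexPolytope.isCompact (h : IsConvexPolytope K) : IsCompact K := by
  obtain ⟨s, hs, rfl⟩ := h.1
  exact hs.isCompact_convexHull ℝ

theorem IsConvexPolytope.convex (h : IsConvexPolytope K) : Convex ℝ K := by
  obtain ⟨s, hs, rfl⟩ := h.1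
  exact convex_convexHull ℝ s

theorem IsConvexPolytope.interior_nonempty (h : IsConvexPolytope K) : (interior K).Nonempty :=
  h.convex.interior_nonempty_iff_affineSpan_eq_top.2 h.2

theorem IsConvexPolytope.nonempty (h : IsConvexPolytope K) : K.Nonempty :=
  h.interior_nonempty.mono interior_subset

/-- An extreme point is a generator outside the hull of the other generators, and a functional
strictly separating it from that hull exposes it. This makes Krein–Milman available for vertices. -/
theorem IsConvexPolytope.vertices_eq_extremePoints (h : IsConvexPolytope K) :
    vertices K = K.extremePoints ℝ := by
  rw [vertices_eq_exposedPoints]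
  refine Set.Subset.antisymm exposedPoints_subset_extremePoints fun v hv => ?_
  obtain ⟨s, hs, rfl⟩ := h.1
  have hvs : v ∈ s := extremePoints_convexHull_subset hv
  have hnot : v ∉ convexHull ℝ (s \ {v}) := fun hmem =>
    (((convex_convexHull ℝ s).mem_extremePoints_iff_mem_sdiff_convexHull_sdiff).1 hv).2
      (convexHull_mono (Set.sdiff_subset_sdiff_left (subset_convexHull ℝ s)) hmem)
  obtain ⟨l, a, hl, ha⟩ := geometric_hahn_banach_closed_point (convex_convexHull ℝ _)
    ((hs.subset Set.sdiff_subset).isCompact_convexHull ℝ).isClosed hnot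
  refine ⟨subset_convexHull ℝ s hvs, l, fun y hy => ?_⟩
  rcases (s \ {v}).eq_empty_or_nonempty with he | hne
  · have hy' : y ∈ convexHull ℝ {v} := convexHull_mono (Set.sdiff_eq_empty.1 he) hy
    rw [convexHull_singleton] at hy'
    simp [Set.mem_singleton_iff.1 hy']
  · rw [← Set.insert_eq_of_mem hvs, ← Set.insert_sdiff_singleton, convexHull_insert hne,
      mem_convexJoin] at hy
    obtain ⟨w, rfl, z, hz, α, β, hα, hβ, hαβ, rfl⟩ := hy
    have hz' := (hl z hz).trans ha
    obtain rfl : α = 1 - β := by linarith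
    simp only [map_add, map_smul, smul_eq_mul]
    refine ⟨by nlinarith, fun hle => ?_⟩
    have : β = 0 := by nlinarith
    simp [this]

theorem IsConvexPolytope.finite_vertices (h : IsConvexPolytope K) : (vertices K).Finite := by
  rw [h.vertices_eq_extremePoints]
  obtain ⟨s, hs, rfl⟩ := h.1
  exact hs.subset extremePoints_convexHull_subset

theorem vertices_subset : vertices K ⊆ K := fun _ hv => hv.1.subset rfl

theorem IsConvexPolytope.closure_convexHull_vertices (h : IsConvexPolytope K) :
    closure (convexHull ℝ (vertices K)) = K := by
  rw [h.vertices_eq_extremePoints]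
  exact closure_convexHull_extremePoints h.isCompact h.convex

theorem IsConvexPolytope.vertices_nonempty (h : IsConvexPolytope K) : (vertices K).Nonempty := by
  rw [h.vertices_eq_extremePoints]
  exact h.isCompact.extremePoints_nonempty h.nonempty

theorem IsConvexPolytope.diam_pos (hd : 1 ≤ d) (h : IsConvexPolytope K) : 0 < Metric.diam K := by
  obtain ⟨p, hp⟩ := h.interior_nonempty
  obtain ⟨ε, hε, hball⟩ := Metric.nhds_basis_closedBall.mem_iff.1 (mem_interior_iff_mem_nhds.1 hp)
  exact hε.trans_le (radius_le_diam hd h.isCompact hε.le hball)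

theorem IsConvexPolytope.inradius_pos (hd : 1 ≤ d) (h : IsConvexPolytope K) : 0 < inradius K := by
  obtain ⟨p, hp⟩ := h.interior_nonempty
  obtain ⟨ε, hε, hball⟩ := Metric.nhds_basis_closedBall.mem_iff.1 (mem_interior_iff_mem_nhds.1 hp)
  exact hε.trans_le (le_inradius hd h.isCompact hε.le hball)

/-! ### Facets -/

/-- For `d = 0` the truncated `d - 1` would make `K` its own facet. -/
theorem IsConvexPolytope.facet_ne (hd : 1 ≤ d) (h : IsConvexPolytope K)
    {f : Set (EuclideanSpace ℝ (Fin d))} (hf : f ∈ facets K) : f ≠ K := by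
  rintro rfl
  have h1 := hf.2.2
  rw [← direction_affineSpan, h.2, AffineSubspace.direction_top, finrank_top,
    finrank_euclideanSpace_fin] at h1
  omega

/-- A facet is the closed convex hull of the vertices that it contains. -/
theorem IsConvexPolytope.closure_convexHull_facet_inter_vertices (h : IsConvexPolytope K)
    {f : Set (EuclideanSpace ℝ (Fin d))} (hf : f ∈ facets K) :
    closure (convexHull ℝ (f ∩ vertices K)) = f := by
  rw [h.vertices_eq_extremePoints, ← hf.1.isExtreme.extremePoints_eq]
  exact closure_convexHull_extremePoints (hf.1.isCompact h.isCompact) (hf.1.convex h.convex)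

theorem IsConvexPolytope.exists_vertex_notMem_facet (hd : 1 ≤ d) (h : IsConvexPolytope K)
    {f : Set (EuclideanSpace ℝ (Fin d))} (hf : f ∈ facets K) : ∃ v ∈ vertices K, v ∉ f := by
  by_contra! hcon
  have h1 := h.closure_convexHull_facet_inter_vertices hf
  rw [Set.inter_eq_right.2 hcon, h.closure_convexHull_vertices] at h1
  exact h.facet_ne hd hf h1.symm

theorem vectorSpan_le_orthogonal {f : Set (EuclideanSpace ℝ (Fin d))}
    {n : EuclideanSpace ℝ (Fin d)} {b : ℝ} (hf : ∀ x ∈ f, inner ℝ n x = b) :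
    vectorSpan ℝ f ≤ (ℝ ∙ n)ᗮ := by
  rw [vectorSpan_def, Submodule.span_le]
  rintro _ ⟨x, hx, y, hy, rfl⟩
  rw [SetLike.mem_coe, Submodule.mem_orthogonal_singleton_iff_inner_right]
  simp [inner_sub_right, hf x hx, hf y hy]

theorem finrank_orthogonal_singleton (hd : 1 ≤ d) {n : EuclideanSpace ℝ (Fin d)} (hn : n ≠ 0) :
    Module.finrank ℝ (ℝ ∙ n)ᗮ = d - 1 := by
  have : Fact (Module.finrank ℝ (EuclideanSpace ℝ (Fin d)) = d - 1 + 1) :=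
    ⟨by rw [finrank_euclideanSpace_fin]; omega⟩
  exact Submodule.finrank_orthogonal_span_singleton hn

/-- By dimension, the direction of `f` is all of the orthogonal complement of `n`, so the projection
of `x` along `n` lands in the affine span of `f`. -/
theorem facetDist_le (hd : 1 ≤ d) {f : Set (EuclideanSpace ℝ (Fin d))} (hf : f ∈ facets K)
    {n : EuclideanSpace ℝ (Fin d)} (hn : ‖n‖ = 1) {b : ℝ} (hb : ∀ x ∈ f, inner ℝ n x = b)
    (x : EuclideanSpace ℝ (Fin d)) : facetDist f x ≤ |b - inner ℝ n x| := by
  have hn0 : n ≠ 0 := by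
    rintro rfl
    simp at hn
  have hspan : vectorSpan ℝ f = (ℝ ∙ n)ᗮ :=
    Submodule.eq_of_le_of_finrank_eq (vectorSpan_le_orthogonal hb)
      (by rw [hf.2.2, finrank_orthogonal_singleton hd hn0])
  obtain ⟨p, hp⟩ := hf.2.1
  have hmem : x + (b - inner ℝ n x) • n ∈ affineSpan ℝ f := by
    rw [← AffineSubspace.vsub_right_mem_direction_iff_mem (subset_affineSpan ℝ f hp),
      direction_affineSpan, hspan, Submodule.mem_orthogonal_singleton_iff_inner_right, vsub_eq_sub,
      inner_sub_right, inner_add_right, inner_smul_right, real_inner_self_eq_norm_sq, hn, hb p hp]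
    ring
  refine (Metric.infDist_le_dist_of_mem hmem).trans ?_
  simp [norm_smul, hn]

/-! ### Facets from extreme points of the polar -/

/-- The polar of `K` with respect to the centre `c`. -/
def polarAt (K : Set (EuclideanSpace ℝ (Fin d))) (c : EuclideanSpace ℝ (Fin d)) :
    Set (EuclideanSpace ℝ (Fin d)) :=
  {n | ∀ y ∈ K, inner ℝ n (y - c) ≤ 1}

theorem mem_polarAt_convexHull {s : Set (EuclideanSpace ℝ (Fin d))}
    {c n : EuclideanSpace ℝ (Fin d)} :
    n ∈ polarAt (convexHull ℝ s) c ↔ ∀ y ∈ s, inner ℝ n (y - c) ≤ 1 := by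
  refine ⟨fun h y hy => h y (subset_convexHull ℝ s hy), fun h y hy => ?_⟩
  have hconv : Convex ℝ {y | inner ℝ n y ≤ 1 + inner ℝ n c} :=
    convex_halfSpace_le (innerSL ℝ n).toLinearMap.isLinear _
  have := convexHull_min (fun z hz => by
    have := h z hz
    rw [inner_sub_right] at this
    show inner ℝ n z ≤ 1 + inner ℝ n c
    linarith) hconv hy
  rw [inner_sub_right]
  have : inner ℝ n y ≤ 1 + inner ℝ n c := this
  linarith

theorem isCompact_polarAt {c : EuclideanSpace ℝ (Fin d)} (hc : c ∈ interior K) :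
    IsCompact (polarAt K c) := by
  obtain ⟨ε, hε, hball⟩ := Metric.nhds_basis_closedBall.mem_iff.1 (mem_interior_iff_mem_nhds.1 hc)
  refine Metric.isCompact_of_isClosed_isBounded ?_ ?_
  · simp only [polarAt, Set.ofPred_forall]
    exact isClosed_biInter fun y _ => isClosed_le (by fun_prop) continuous_const
  · refine (Metric.isBounded_closedBall (x := 0) (r := 1 / ε)).subset fun n hn => ?_
    rcases eq_or_ne n 0 with rfl | hn0
    · simp [hε.le]
    have hpos := norm_pos_iff.2 hn0
    have h1 := hn (c + (ε / ‖n‖) • n) (hball (by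
      simp [norm_smul, abs_of_pos hε, hpos.ne']))
    rw [add_sub_cancel_left, inner_smul_right, real_inner_self_eq_norm_sq] at h1
    rw [mem_closedBall_zero_iff, le_div_iff₀ hε]
    calc ‖n‖ * ε = ε / ‖n‖ * ‖n‖ ^ 2 := by field_simp
      _ ≤ 1 := h1

/-- The points at which an extreme point of the polar is tight span the whole space. -/
theorem span_tight_eq_top {s : Set (EuclideanSpace ℝ (Fin d))} (hs : s.Finite)
    {c n : EuclideanSpace ℝ (Fin d)} (hn : n ∈ (polarAt (convexHull ℝ s) c).extremePoints ℝ) :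
    Submodule.span ℝ {z | z + c ∈ s ∧ inner ℝ n z = 1} = ⊤ := by
  -- If `m` is orthogonal to all tight points, then `n ± ε m` stays in the polar for small `ε`, as
  -- the finitely many other constraints are slack. Extremality forces `m = 0`.
  rw [← Submodule.orthogonal_eq_bot_iff, Submodule.eq_bot_iff]
  intro m hm
  rw [mem_extremePoints] at hn
  have htight : ∀ y ∈ s, inner ℝ n (y - c) = 1 → inner ℝ m (y - c) = 0 := fun y hy h1 => by
    rw [real_inner_comm]
    exact hm _ (Submodule.subset_span ⟨by simpa using hy, h1⟩)
  have hev : ∀ y ∈ s, ∀ᶠ ε in 𝓝 (0 : ℝ), inner ℝ (n + ε • m) (y - c) ≤ 1 := by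
    intro y hy
    rcases (mem_polarAt_convexHull.1 hn.1 y hy).eq_or_lt with h1 | h1
    · filter_upwards with ε
      rw [inner_add_left, real_inner_smul_left, htight y hy h1, h1]
      simp
    · have hcont : Continuous fun ε : ℝ => inner ℝ (n + ε • m) (y - c) := by fun_prop
      have : inner ℝ (n + (0 : ℝ) • m) (y - c) < 1 := by simpa using h1
      filter_upwards [hcont.continuousAt.eventually_lt_const this] with ε hε using hε.le
  have hall : ∀ᶠ ε in 𝓝 (0 : ℝ), n + ε • m ∈ polarAt (convexHull ℝ s) c := by
    simp only [mem_polarAt_convexHull]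
    exact (hs.eventually_all).2 hev
  obtain ⟨δ, hδ, hball⟩ := Metric.eventually_nhds_iff.1 hall
  have h1 := hball (y := δ / 2) (by simp [abs_of_pos hδ, hδ])
  have h2 := hball (y := -(δ / 2)) (by simp [abs_of_pos hδ, hδ])
  have h3 := (hn.2 _ h1 _ h2 ⟨1 / 2, 1 / 2, by norm_num, by norm_num, by norm_num, by module⟩).1
  have h4 : (δ / 2) • m = 0 := by simpa using h3
  exact (smul_eq_zero.1 h4).resolve_left (by positivity)

/-- Extreme points of the polar are normals of facets. -/
theorem IsConvexPolytope.facet_of_mem_extremePoints_polarAt (hd : 1 ≤ d) (h : IsConvexPolytope K)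
    {c n : EuclideanSpace ℝ (Fin d)} (hn : n ∈ (polarAt K c).extremePoints ℝ) :
    {x ∈ K | inner ℝ n (x - c) = 1} ∈ facets K := by
  obtain ⟨s, hs, rfl⟩ := h.1
  have hspan := span_tight_eq_top hs hn
  set T := {z | z + c ∈ s ∧ inner ℝ n z = 1}
  set f := {x ∈ convexHull ℝ s | inner ℝ n (x - c) = 1} with hf
  have hTf : ∀ z ∈ T, z + c ∈ f := fun z hz => ⟨subset_convexHull ℝ s hz.1, by simpa using hz.2⟩
  have hT : T.Nonempty := by
    rw [Set.nonempty_iff_ne_empty]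
    intro he
    rw [he, Submodule.span_empty] at hspan
    obtain ⟨e, he⟩ := exists_norm_eq_one hd
    have : e ∈ (⊥ : Submodule ℝ (EuclideanSpace ℝ (Fin d))) := hspan ▸ Submodule.mem_top
    simp [(Submodule.mem_bot ℝ).1 this] at he
  obtain ⟨t, ht⟩ := hT
  have hn0 : n ≠ 0 := by
    rintro rfl
    simpa using ht.2
  have hfb : ∀ x ∈ f, inner ℝ n x = 1 + inner ℝ n c := fun x hx => by
    have := hx.2
    rw [inner_sub_right] at this
    linarith
  refine ⟨fun _ => ⟨innerSL ℝ n, ?_⟩, ⟨_, hTf t ht⟩, ?_⟩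
  · ext x
    simp only [hf, innerSL_apply_apply]
    refine ⟨fun hx => ⟨hx.1, fun y hy => ?_⟩, fun hx => ⟨hx.1, le_antisymm (hn.1 x hx.1) ?_⟩⟩
    · have h1 := hn.1 y hy
      rw [inner_sub_right] at h1
      linarith [hfb x hx]
    · have h1 := hx.2 _ (hTf t ht).1
      rw [hfb _ (hTf t ht)] at h1
      rw [inner_sub_right]
      linarith
  · rw [← finrank_orthogonal_singleton hd hn0]
    suffices h : vectorSpan ℝ f = (ℝ ∙ n)ᗮ by rw [h]
    refine le_antisymm (vectorSpan_le_orthogonal hfb) fun y hy => ?_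
    rw [Submodule.mem_orthogonal_singleton_iff_inner_right] at hy
    -- Since `z = t + (z - t)`, the directions of `f` and `t` together span the space; pairing with
    -- `n` then removes the `t` component.
    have hle : Submodule.span ℝ T ≤ (ℝ ∙ t) ⊔ vectorSpan ℝ f := by
      refine Submodule.span_le.2 fun z hz => ?_
      have h1 : z - t ∈ vectorSpan ℝ f := by
        simpa using vsub_mem_vectorSpan ℝ (hTf z hz) (hTf t ht)
      exact Submodule.mem_sup.2 ⟨t, Submodule.mem_span_singleton_self t, _, h1, by simp⟩
    obtain ⟨u, hu, w, hw, rfl⟩ := Submodule.mem_sup.1 (hle (hspan ▸ Submodule.mem_top : y ∈ _))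
    obtain ⟨a, rfl⟩ := Submodule.mem_span_singleton.1 hu
    have hw0 := Submodule.mem_orthogonal_singleton_iff_inner_right.1
      (vectorSpan_le_orthogonal hfb hw)
    rw [inner_add_right, inner_smul_right, ht.2, hw0] at hy
    obtain rfl : a = 0 := by simpa using hy
    simpa using hw

/-- A point outside of a polytope is separated from it by the hyperplane of a facet. -/
theorem IsConvexPolytope.exists_facet_separating (hd : 1 ≤ d) (h : IsConvexPolytope K)
    {x : EuclideanSpace ℝ (Fin d)} (hx : x ∉ K) :
    ∃ f ∈ facets K, ∃ (n : EuclideanSpace ℝ (Fin d)) (b : ℝ), ‖n‖ = 1 ∧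
      (∀ y ∈ K, inner ℝ n y ≤ b) ∧ (∀ y ∈ f, inner ℝ n y = b) ∧ b < inner ℝ n x := by
  obtain ⟨c, hc⟩ := h.interior_nonempty
  have hcK := interior_subset hc
  have hP := isCompact_polarAt hc
  -- A separating functional, rescaled so that it lies in the polar.
  obtain ⟨m, hm, hmx⟩ : ∃ m ∈ polarAt K c, 1 < inner ℝ m (x - c) := by
    obtain ⟨l, a, hl, ha⟩ := geometric_hahn_banach_closed_point h.convex h.isCompact.isClosed hx
    let m := (InnerProductSpace.toDual ℝ (EuclideanSpace ℝ (Fin d))).symm l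
    have hm : ∀ y, inner ℝ m y = l y := fun y => by simp [m]
    have hpos : 0 < a - l c := sub_pos.2 (hl c hcK)
    refine ⟨(a - l c)⁻¹ • m, fun y hy => ?_, ?_⟩
    · rw [real_inner_smul_left, hm, map_sub, inv_mul_le_one₀ hpos]
      linarith [hl y hy]
    · rw [real_inner_smul_left, hm, map_sub, ← div_eq_inv_mul, one_lt_div hpos]
      linarith
  let g : EuclideanSpace ℝ (Fin d) →L[ℝ] ℝ := innerSL ℝ (x - c)
  have hexp : IsExposed ℝ (polarAt K c) (g.toExposed (polarAt K c)) :=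
    ContinuousLinearMap.toExposed.isExposed
  -- An extreme point of the face of the polar maximising the pairing with `x - c` is extreme in the
  -- polar and separates at least as well as `m`.
  obtain ⟨q, hq, hqm⟩ := hP.exists_isMaxOn ⟨m, hm⟩ g.continuous.continuousOn
  obtain ⟨n, hn⟩ := (hexp.isCompact hP).extremePoints_nonempty ⟨q, hq, fun y hy => hqm hy⟩
  have hn' := hexp.isExtreme.extremePoints_subset_extremePoints hn
  have hnx : 1 < inner ℝ n (x - c) := by
    have := hn.1.2 m hm
    simp only [g, innerSL_apply_apply] at this
    rw [real_inner_comm] at this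
    rw [real_inner_comm]
    linarith
  have hn0 : 0 < ‖n‖ := norm_pos_iff.2 (by
    rintro rfl
    simp at hnx
    linarith)
  refine ⟨_, h.facet_of_mem_extremePoints_polarAt hd hn', ‖n‖⁻¹ • n, ‖n‖⁻¹ * (1 + inner ℝ n c),
    by simp [norm_smul, hn0.ne'], fun y hy => ?_, fun y hy => ?_, ?_⟩
  · have := hn'.1 y hy
    rw [inner_sub_right] at this
    rw [real_inner_smul_left]
    gcongr
    linarith
  · have := hy.2
    rw [inner_sub_right] at this
    rw [real_inner_smul_left]
    congr 1
    linarith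
  · rw [inner_sub_right] at hnx
    rw [real_inner_smul_left]
    gcongr
    linarith

/-- Two vertices are distinguished by a facet. -/
theorem IsConvexPolytope.exists_facet_mem_notMem (hd : 1 ≤ d) (h : IsConvexPolytope K)
    {u v : EuclideanSpace ℝ (Fin d)} (hu : u ∈ vertices K) (hv : v ∈ vertices K) (huv : u ≠ v) :
    ∃ f ∈ facets K, u ∈ f ∧ v ∉ f := by
  obtain ⟨c, hc⟩ := h.interior_nonempty
  have hcK := interior_subset hc
  have hP := isCompact_polarAt hc
  have huK := vertices_subset hu
  have hvK := vertices_subset hv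
  -- An interior point is the midpoint of a segment in `K`, hence not a vertex.
  have huc : c ≠ u := by
    rintro rfl
    rw [h.vertices_eq_extremePoints] at hu
    obtain ⟨ε, hε, hball⟩ := Metric.nhds_basis_closedBall.mem_iff.1 (mem_interior_iff_mem_nhds.1 hc)
    obtain ⟨e, he⟩ := exists_norm_eq_one hd
    have h1 := ((mem_extremePoints.1 hu).2 (c + ε • e) (hball (by
      simp [norm_smul, he, abs_of_pos hε])) (c - ε • e) (hball (by
      simp [norm_smul, he, abs_of_pos hε]))
      ⟨1 / 2, 1 / 2, by norm_num, by norm_num, by norm_num, by module⟩).1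
    have h2 : ε • e = 0 := by simpa using h1
    have h3 := congrArg norm h2
    rw [norm_smul, he] at h3
    simp [hε.ne'] at h3
  obtain ⟨m, hm, hmu, hmv⟩ :
      ∃ m ∈ polarAt K c, inner ℝ m (u - c) = 1 ∧ inner ℝ m (v - c) < 1 := by
    rw [vertices_eq_exposedPoints] at hu
    obtain ⟨-, l, hl⟩ := hu
    let m := (InnerProductSpace.toDual ℝ (EuclideanSpace ℝ (Fin d))).symm l
    have hm : ∀ y, inner ℝ m y = l y := fun y => by simp [m]
    have hlt : ∀ y ∈ K, y ≠ u → l y < l u := fun y hy hne =>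
      lt_of_not_ge fun hge => hne ((hl y hy).2 hge)
    have hpos : 0 < l u - l c := sub_pos.2 (hlt c hcK huc)
    refine ⟨(l u - l c)⁻¹ • m, fun y hy => ?_, ?_, ?_⟩
    · rw [real_inner_smul_left, hm, map_sub, inv_mul_le_one₀ hpos]
      linarith [(hl y hy).1]
    · rw [real_inner_smul_left, hm, map_sub, inv_mul_cancel₀ hpos.ne']
    · rw [real_inner_smul_left, hm, map_sub, inv_mul_lt_one₀ hpos]
      linarith [hlt v hvK huv.symm]
  let g : EuclideanSpace ℝ (Fin d) →L[ℝ] ℝ := innerSL ℝ (u - c)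
  let k : EuclideanSpace ℝ (Fin d) →L[ℝ] ℝ := -innerSL ℝ (v - c)
  have hg : ∀ n, g n = inner ℝ n (u - c) := fun n => real_inner_comm n (u - c)
  have hk : ∀ n, k n = -inner ℝ n (v - c) := fun n => by
    rw [real_inner_comm]
    rfl
  have hexp : IsExposed ℝ (polarAt K c) (g.toExposed (polarAt K c)) :=
    ContinuousLinearMap.toExposed.isExposed
  -- `G` consists of the polar points tight at `u`. Minimising the value at `v` over `G` keeps it
  -- below 1, because `m` lies in `G`; an extreme minimiser is a facet normal.
  set G := g.toExposed (polarAt K c)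
  have hGm : m ∈ G := ⟨hm, fun n hn => by
    rw [hg, hg, hmu]
    exact hn u huK⟩
  have hG := hexp.isCompact hP
  have hexp' : IsExposed ℝ G (k.toExposed G) := ContinuousLinearMap.toExposed.isExposed
  obtain ⟨q, hq, hqm⟩ := hG.exists_isMaxOn ⟨m, hGm⟩ k.continuous.continuousOn
  obtain ⟨n, hn⟩ := (hexp'.isCompact hG).extremePoints_nonempty ⟨q, hq, fun y hy => hqm hy⟩
  have hn' := hexp.isExtreme.extremePoints_subset_extremePoints
    (hexp'.isExtreme.extremePoints_subset_extremePoints hn)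
  refine ⟨_, h.facet_of_mem_extremePoints_polarAt hd hn', ⟨huK, ?_⟩, fun hcon => ?_⟩
  · have := hn.1.1.2 m hm
    rw [hg, hg, hmu] at this
    exact le_antisymm (hn'.1 u huK) this
  · have := hn.1.2 m hGm
    rw [hk, hk, hcon.2] at this
    linarith

/-! ### The implications between the conditions -/

/-- Sets are bounded in number if their elements inject into the subsets of a bounded set. -/
theorem encard_le_two_pow_of_injOn {α β : Type*} {A : Set α} {B : Set β} {N : ℕ}
    (hB : B.encard ≤ N) {g : α → Set β} (hg : ∀ a ∈ A, g a ⊆ B) (hinj : Set.InjOn g A) :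
    A.encard ≤ (2 ^ N : ℕ) := by
  have hfin : B.Finite := Set.finite_of_encard_le_coe hB
  refine (Set.encard_le_encard_of_injOn (t := 𝒫 B) hg hinj).trans ?_
  rw [← hfin.powerset.cast_ncard_eq, Set.ncard_powerset B hfin]
  rw [← hfin.cast_ncard_eq] at hB
  have : B.ncard ≤ N := by exact_mod_cast hB
  exact_mod_cast Nat.pow_le_pow_right two_pos this

theorem H1.le_facetDist {C : ℝ} (h : H1 C K) {f : Set (EuclideanSpace ℝ (Fin d))}
    (hf : f ∈ facets K) {v : EuclideanSpace ℝ (Fin d)} (hv : v ∈ vertices K) (hvf : v ∉ f) :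
    C * Metric.diam K ≤ facetDist f v := by
  refine le_trans h (csInf_le ⟨0, ?_⟩ ⟨f, hf, v, hv, hvf, rfl⟩)
  rintro r ⟨g, -, w, -, -, rfl⟩
  exact Metric.infDist_nonneg

theorem H1.toH2 (hd : 1 ≤ d) (hK : IsConvexPolytope K) {C : ℝ} (h : H1 C K) : H2 C K := by
  intro u hu v hv huv
  obtain ⟨f, hf, huf, hvf⟩ := hK.exists_facet_mem_notMem hd hu hv huv
  refine (h.le_facetDist hf hv hvf).trans ?_
  rw [dist_comm]
  exact Metric.infDist_le_dist_of_mem (subset_affineSpan ℝ f huf)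

theorem exists_forall_H2_imp_H3 (hd : 1 ≤ d) {D : ℝ} (hD : 0 < D) : ∃ N : ℕ, 0 < N ∧
    ∀ K : Set (EuclideanSpace ℝ (Fin d)), IsConvexPolytope K → H2 D K → H3 N K := by
  -- The cover is chosen before `K`, so `N` depends only on `d` and `D`. Balls of radius `D / 2`
  -- contain at most one rescaled vertex each; the `+ 1` below only makes `N` positive.
  obtain ⟨t, -, ht, hcover⟩ := (isCompact_closedBall (0 : EuclideanSpace ℝ (Fin d)) 1
    ).finite_cover_balls (half_pos hD)
  refine ⟨t.ncard + 1, Nat.succ_pos _, fun K hK h => ?_⟩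
  have hpos := hK.diam_pos hd
  obtain ⟨x, hx⟩ := hK.vertices_nonempty
  let φ : EuclideanSpace ℝ (Fin d) → EuclideanSpace ℝ (Fin d) :=
    fun v => (Metric.diam K)⁻¹ • (v - x)
  have hφ : ∀ u v, dist (φ u) (φ v) = dist u v / Metric.diam K := fun u v => by
    simp only [φ, dist_eq_norm, ← smul_sub, norm_smul, sub_sub_sub_cancel_right]
    rw [Real.norm_of_nonneg (by positivity)]
    ring
  have hex : ∀ v ∈ vertices K, ∃ y ∈ t, dist (φ v) y < D / 2 := fun v hv => by
    have hmem : φ v ∈ Metric.closedBall (0 : EuclideanSpace ℝ (Fin d)) 1 := by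
      have h0 : φ x = 0 := by simp [φ]
      rw [Metric.mem_closedBall, ← h0, hφ, div_le_one hpos]
      exact Metric.dist_le_diam_of_mem hK.isCompact.isBounded (vertices_subset hv)
        (vertices_subset hx)
    simpa using hcover hmem
  choose! y hyt hyd using hex
  have hinj : Set.InjOn y (vertices K) := fun u hu v hv huv => by
    by_contra hne
    have h1 := h u hu v hv hne
    rw [← le_div_iff₀ hpos, ← hφ] at h1
    have h2 := hyd u hu
    have h3 := hyd v hv
    rw [← huv] at h3
    linarith [dist_triangle_right (φ u) (φ v) (y u)]
  refine (Set.encard_le_encard_of_injOn hyt hinj).trans ?_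
  rw [← ht.cast_ncard_eq]
  exact_mod_cast Nat.le_succ _

theorem H3.toH4 (hK : IsConvexPolytope K) {N : ℕ} (h : H3 N K) : H4 (2 ^ N) K := by
  refine encard_le_two_pow_of_injOn h (g := fun f => f ∩ vertices K)
    (fun f _ => Set.inter_subset_right) fun f hf g hg hfg => ?_
  rw [← hK.closure_convexHull_facet_inter_vertices hf,
    ← hK.closure_convexHull_facet_inter_vertices hg]
  exact congrArg _ (congrArg _ hfg)

theorem H4.toH3 (hd : 1 ≤ d) (hK : IsConvexPolytope K) {N : ℕ} (h : H4 N K) : H3 (2 ^ N) K := by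
  refine encard_le_two_pow_of_injOn h (g := fun v => {f ∈ facets K | v ∈ f})
    (fun f _ => Set.sep_subset _ _) fun u hu v hv huv => ?_
  by_contra hne
  obtain ⟨f, hf, huf, hvf⟩ := hK.exists_facet_mem_notMem hd hu hv hne
  have huf' : f ∈ {f ∈ facets K | u ∈ f} := ⟨hf, huf⟩
  exact hvf ((Set.ext_iff.1 huv f).1 huf').2

/-- The ball around the mean of the vertices with radius `C h_K / N` is contained in `K`. -/
theorem exists_closedBall_subset_of_H1_of_H3 (hd : 1 ≤ d) (hK : IsConvexPolytope K) {C : ℝ}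
    (hC : 0 < C) (h1 : H1 C K) {N : ℕ} (h3 : H3 N K) :
    ∃ c, Metric.closedBall c (C * Metric.diam K / N) ⊆ K := by
  classical
  set t := hK.finite_vertices.toFinset with ht
  have hmem : ∀ v, v ∈ t ↔ v ∈ vertices K := fun v => by simp [ht]
  have htpos : 0 < (t.card : ℝ) := by
    obtain ⟨v, hv⟩ := hK.vertices_nonempty
    exact_mod_cast Finset.card_pos.2 ⟨v, (hmem v).2 hv⟩
  have htN : (t.card : ℝ) ≤ N := by
    have h : (vertices K).encard ≤ N := h3
    rw [hK.finite_vertices.encard_eq_coe_toFinset_card] at h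
    exact_mod_cast h
  refine ⟨(t.card : ℝ)⁻¹ • ∑ v ∈ t, v, fun z hz => ?_⟩
  by_contra hzK
  obtain ⟨f, hf, n, b, hn, hb, hfb, hlt⟩ := hK.exists_facet_separating hd hzK
  obtain ⟨v₀, hv₀, hv₀f⟩ := hK.exists_vertex_notMem_facet hd hf
  have hsub : ∀ v ∈ t, 0 ≤ b - inner ℝ n v := fun v hv =>
    sub_nonneg.2 (hb v (vertices_subset ((hmem v).1 hv)))
  have hv₀b : C * Metric.diam K ≤ b - inner ℝ n v₀ := by
    refine (h1.le_facetDist hf hv₀ hv₀f).trans ((facetDist_le hd hf hn hfb v₀).trans_eq ?_)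
    exact abs_of_nonneg (hsub v₀ ((hmem v₀).2 hv₀))
  -- The sum of the nonnegative slacks `b - ⟪n, v⟫` dominates the single slack at `v₀`.
  have hsum : C * Metric.diam K ≤ t.card * b - inner ℝ n (∑ v ∈ t, v) := by
    refine hv₀b.trans ((Finset.single_le_sum hsub ((hmem v₀).2 hv₀)).trans_eq ?_)
    rw [inner_sum, Finset.sum_sub_distrib]
    simp
  have hz1 : inner ℝ n z ≤ (t.card : ℝ)⁻¹ * inner ℝ n (∑ v ∈ t, v) + C * Metric.diam K / N := by
    have h := (real_inner_le_norm n (z - (t.card : ℝ)⁻¹ • ∑ v ∈ t, v)).trans_eq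
      (by rw [hn, one_mul])
    rw [inner_sub_right, inner_smul_right] at h
    rw [Metric.mem_closedBall, dist_eq_norm] at hz
    linarith
  have hdiam : 0 ≤ C * Metric.diam K := mul_nonneg hC.le Metric.diam_nonneg
  have hdiv : C * Metric.diam K / N ≤ C * Metric.diam K / t.card := by gcongr
  have hfin : C * Metric.diam K / t.card ≤ b - (t.card : ℝ)⁻¹ * inner ℝ n (∑ v ∈ t, v) := by
    rw [div_le_iff₀ htpos]
    calc C * Metric.diam K ≤ t.card * b - inner ℝ n (∑ v ∈ t, v) := hsum
      _ = (b - (t.card : ℝ)⁻¹ * inner ℝ n (∑ v ∈ t, v)) * t.card := by field_simp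
  linarith

theorem exists_forall_H1_imp_H5 (hd : 1 ≤ d) {C : ℝ} (hC : 0 < C) : ∃ C' : ℝ, 0 < C' ∧
    ∀ K : Set (EuclideanSpace ℝ (Fin d)), IsConvexPolytope K → H1 C K → H5 C' K := by
  obtain ⟨N, hN, h⟩ := exists_forall_H2_imp_H3 hd hC
  have hN' : (0 : ℝ) < N := by exact_mod_cast hN
  refine ⟨2 * (C / N), by positivity, fun K hK h1 => ?_⟩
  obtain ⟨c, hc⟩ := exists_closedBall_subset_of_H1_of_H3 hd hK hC h1 (h K hK (h1.toH2 hd hK))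
  have hdiam : 0 ≤ Metric.diam K := Metric.diam_nonneg
  refine le_trans (le_of_eq ?_)
    (two_mul_radius_le_width hd hK.isCompact (by positivity) hc)
  ring

theorem H5.toH5' (hd : 1 ≤ d) (hK : IsConvexPolytope K) {C : ℝ} (hC : 0 < C) (h : H5 C K) :
    H5' (2 * (d * (d + 1)) / C) K := by
  have h1 : C * Metric.diam K ≤ _ :=
    le_trans h (width_le_mul_inradius hd hK.isCompact hK.convex hK.interior_nonempty)
  have : Metric.diam K / inradius K ≤ 2 * (d * (d + 1)) / C := by
    rw [div_le_div_iff₀ (hK.inradius_pos hd) hC]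
    linarith
  exact this

theorem H5'.toH5 (hd : 1 ≤ d) (hK : IsConvexPolytope K) {γ : ℝ} (hγ : 0 < γ) (h : H5' γ K) :
    H5 (2 / γ) K := by
  have h1 : Metric.diam K ≤ γ * inradius K := (div_le_iff₀ (hK.inradius_pos hd)).1 h
  calc 2 / γ * Metric.diam K ≤ 2 / γ * (γ * inradius K) := by gcongr
    _ = 2 * inradius K := by field_simp
    _ ≤ width K := two_mul_inradius_le_width hd hK.isCompact hK.nonempty

end PolytopeGeom

theorem mainTheorem5 (d : ℕ) (hd : 1 ≤ d) :
    -- (H1) implies (H2)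
    (∀ C : ℝ, 0 < C → ∃ D : ℝ, 0 < D ∧
      ∀ K : Set (EuclideanSpace ℝ (Fin d)), IsSimplePolytope K → H1 C K → H2 D K) ∧
    -- (H2) implies (H3)
    (∀ D : ℝ, 0 < D → ∃ N : ℕ, 0 < N ∧
      ∀ K : Set (EuclideanSpace ℝ (Fin d)), IsSimplePolytope K → H2 D K → H3 N K) ∧
    -- (H3) implies (H4)
    (∀ N : ℕ, 0 < N → ∃ M : ℕ, 0 < M ∧
      ∀ K : Set (EuclideanSpace ℝ (Fin d)), IsSimplePolytope K → H3 N K → H4 M K) ∧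
    -- (H4) implies (H3)
    (∀ M : ℕ, 0 < M → ∃ N : ℕ, 0 < N ∧
      ∀ K : Set (EuclideanSpace ℝ (Fin d)), IsSimplePolytope K → H4 M K → H3 N K) ∧
    -- (H1) implies (H5)
    (∀ C : ℝ, 0 < C → ∃ C' : ℝ, 0 < C' ∧
      ∀ K : Set (EuclideanSpace ℝ (Fin d)), IsSimplePolytope K → H1 C K → H5 C' K) ∧
    -- (H5) implies (H5')
    (∀ C : ℝ, 0 < C → ∃ γ : ℝ, 0 < γ ∧
      ∀ K : Set (EuclideanSpace ℝ (Fin d)), IsSimplePolytope K → H5 C K → H5' γ K) ∧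
    -- (H5') implies (H5)
    (∀ γ : ℝ, 0 < γ → ∃ C : ℝ, 0 < C ∧
      ∀ K : Set (EuclideanSpace ℝ (Fin d)), IsSimplePolytope K → H5' γ K → H5 C K) := by
  have hd' : (0 : ℝ) < d := by exact_mod_cast hd
  refine ⟨fun C hC => ⟨C, hC, fun K hK h => h.toH2 hd hK.isConvexPolytope⟩, fun D hD => ?_,
    fun N _ => ⟨2 ^ N, by positivity, fun K hK h => h.toH4 hK.isConvexPolytope⟩,
    fun M _ => ⟨2 ^ M, by positivity, fun K hK h => h.toH3 hd hK.isConvexPolytope⟩,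
    fun C hC => ?_,
    -- Unification with `H5.toH5'` and `H5'.toH5` supplies the constants `2d(d+1)/C` and `2/γ`.
    fun C hC => ⟨_, by positivity, fun K hK h => h.toH5' hd hK.isConvexPolytope hC⟩,
    fun γ hγ => ⟨_, by positivity, fun K hK h => h.toH5 hd hK.isConvexPolytope hγ⟩⟩
  · obtain ⟨N, hN, h⟩ := exists_forall_H2_imp_H3 hd hD
    exact ⟨N, hN, fun K hK => h K hK.isConvexPolytope⟩
  · obtain ⟨C', hC', h⟩ := exists_forall_H1_imp_H5 hd hC
    exact ⟨C', hC', fun K hK => h K hK.isConvexPolytope⟩
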